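/- Write points of $\mathbb{R}^{n+m}$ as $\mathbf z=(x,y)$, $x\in\mathbb{R}^n$, $y\in\mathbb{R}^m$, with the Euclidean norm. Let $K\subseteq\mathbb{R}^{n+m}$ be non-empty, closed and convex, and let $\varphi:\mathbb{R}^{n+m}\to\mathbb{R}$ be $C^2$ and concave-convex (concave in $x$ for each fixed $y$, convex in $y$ for each fixed $x$). Put $\mathbf f=(\varphi_x,-\varphi_y)$. For a closed convex set $C$ let $N_C(\mathbf z)=\{\mathbf w:\langle \mathbf w,\mathbf v-\mathbf z\rangle\le 0\ \ \forall\,\mathbf v\in C\}$ be its normal cone at $\mathbf z\in C$, and let $\mathbf P_C$ be the nearest-point projection onto $C\neq\emptyset$. For non-empty closed convex $C$, the subgradient method on $C$ is the semi-flow on $C$ (a continuous map $\phi:[0,\infty)\times C\to C$ with $\phi(0,\mathbf z)=\mathbf z$ and $\phi(t+s,\mathbf z)=\phi(t,\phi(s,\mathbf z))$) whose trajectories are Carathéodory solutions (locally absolutely continuous in $t$, the equation holding for almost every $t\ge 0$) of $$\dot{\mathbf z}=\mathbf f(\mathbf z)-\mathbf P_{N_C(\mathbf z)}(\mathbf f(\mathbf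 z)).$$ A semi-flow is globally convergent if for every trajectory the distance to the set of equilibrium points (points fixed by the semi-flow for all times) tends to $0$ as $t\to\infty$, where the distance to the empty set is $+\infty$. "The subgradient method on $C$ is globally convergent" means that this semi-flow exists and is globally convergent. A stationary $K$-restricted saddle point of $\varphi$ is a point $\bar{\mathbf z}=(\bar x,\bar y)\in K$ such that $\varphi(x,\bar y)\le\varphi(\bar x,\bar y)\le\varphi(\bar x,y)$ whenever $(x,\bar y)\in K$, respectively $(\bar x,y)\in K$, and such that $\mathbf f(\bar{\mathbf z})\in N_K(\bar{\mathbf z})$ (the last condition follows from the inequalities if $K=K_x\times K_y$ is a product of convex sets $K_x\subseteq\mathbb{R}^n$, $K_y\subseteq\mathbb{R}^m$). A face of $K$ is a convex subset $F\subseteq K$ that contains every line segment in $K$ whose relative interior meets $F$. Assume that $\varphi$ has a stationary $K$-restricted saddle point, and that for every face $F$ of $K$ that contains a stationary $K$-restricted saddle point, the subgradient method on the affine span of $F$ is globally convergent. Then the subgradient method on $K$ is globally convergent. -/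

import Mathlib

open Set Filter Topology MeasureTheory
open scoped NNReal

noncomputable section

namespace Subgradient

/-- The Euclidean space `ℝⁿ⁺ᵐ`, with coordinates indexed by the disjoint union of `Fin n` (the
coordinates of `x`) and `Fin m` (the coordinates of `y`). -/
abbrev Space (n m : ℕ) : Type :=
  EuclideanSpace ℝ (Fin n ⊕ Fin m)

variable {n m : ℕ}

/-- The point `(x, y)` of `ℝⁿ⁺ᵐ`. -/
def pt (x : EuclideanSpace ℝ (Fin n)) (y : EuclideanSpace ℝ (Fin m)) : Space n m :=
  WithLp.toLp 2 (Sum.elim x y)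

/-- The component `x` of `z = (x, y)`. -/
def xPart (z : Space n m) : EuclideanSpace ℝ (Fin n) :=
  WithLp.toLp 2 fun i => z (Sum.inl i)

/-- The component `y` of `z = (x, y)`. -/
def yPart (z : Space n m) : EuclideanSpace ℝ (Fin m) :=
  WithLp.toLp 2 fun j => z (Sum.inr j)

/-- `φ` is concave-convex on `ℝⁿ⁺ᵐ`: concave in `x` for each fixed `y` and convex in `y` for each
fixed `x`. -/
def ConcaveConvex (φ : Space n m → ℝ) : Prop :=
  (∀ y, ConcaveOn ℝ univ fun x => φ (pt x y)) ∧ (∀ x, ConvexOn ℝ univ fun y => φ (pt x y))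

/-- The vector field `f = (φ_x, -φ_y)` of the gradient method, given by partial gradients. -/
def gradField (φ : Space n m → ℝ) (z : Space n m) : Space n m :=
  pt (gradient (fun x => φ (pt x (yPart z))) (xPart z)) (-gradient (fun y => φ (pt (xPart z) y)) (yPart z))

/-- The normal cone `N_K(z)` to the set `K` through `z`. -/
def normalCone (K : Set (Space n m)) (z : Space n m) : Set (Space n m) :=
  {w | ∀ v ∈ K, inner ℝ w (v - z) ≤ 0}

open Classical in
/-- The projection `P_C(u)`: the point of `C` nearest to `u` (see `proj_spec` and `eq_proj`). -/
def proj (C : Set (Space n m)) (u : Space n m) : Space n m :=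
  if h : ∃ p ∈ C, ∀ c ∈ C, ‖u - p‖ ≤ ‖u - c‖ then h.choose else 0

/-- For a non-empty closed convex set the nearest point exists. -/
theorem proj_spec {C : Set (Space n m)} (hne : C.Nonempty) (hcl : IsClosed C) (hC : Convex ℝ C)
    (u : Space n m) : proj C u ∈ C ∧ ∀ c ∈ C, ‖u - proj C u‖ ≤ ‖u - c‖ := by
  have h : ∃ p ∈ C, ∀ c ∈ C, ‖u - p‖ ≤ ‖u - c‖ := by
    obtain ⟨p, hp, hmin⟩ := exists_norm_eq_iInf_of_complete_convex hne hcl.isComplete hC u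
    refine ⟨p, hp, fun c hc => ?_⟩
    rw [hmin]
    exact ciInf_le (f := fun w : C => ‖u - w‖) ⟨0, by rintro _ ⟨w, rfl⟩; exact norm_nonneg _⟩ ⟨c, hc⟩
  unfold proj
  rw [dif_pos h]
  exact h.choose_spec

/-- For a convex set the nearest point is unique. -/
theorem eq_proj {C : Set (Space n m)} (hC : Convex ℝ C) {u p : Space n m} (hp : p ∈ C)
    (hmin : ∀ c ∈ C, ‖u - p‖ ≤ ‖u - c‖) : p = proj C u := by
  have h : ∃ p ∈ C, ∀ c ∈ C, ‖u - p‖ ≤ ‖u - c‖ := ⟨p, hp, hmin⟩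
  have key : ∀ q ∈ C, (∀ c ∈ C, ‖u - q‖ ≤ ‖u - c‖) → ∀ w ∈ C, inner ℝ (u - q) (w - q) ≤ 0 := by
    intro q hq hqm
    rw [← norm_eq_iInf_iff_real_inner_le_zero hC hq]
    have : Nonempty C := ⟨⟨q, hq⟩⟩
    refine le_antisymm (le_ciInf fun w => hqm w w.2) ?_
    exact ciInf_le (f := fun w : C => ‖u - w‖) ⟨0, by rintro _ ⟨w, rfl⟩; exact norm_nonneg _⟩ ⟨q, hq⟩
  unfold proj
  rw [dif_pos h]
  obtain ⟨hq, hqm⟩ := h.choose_spec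
  generalize h.choose = q at hq hqm
  have h1 := key p hp hmin q hq
  have h2 := key q hq hqm p hp
  have h3 : inner ℝ (q - p) (q - p) ≤ 0 := by
    have e : q - p = (u - p) - (u - q) := by abel
    have e2 : inner ℝ (u - q) (p - q) = -inner ℝ (u - q) (q - p) := by
      rw [← inner_neg_right, neg_sub]
    calc inner ℝ (q - p) (q - p) = inner ℝ (u - p) (q - p) - inner ℝ (u - q) (q - p) := by
          rw [← inner_sub_left, ← e]
      _ ≤ 0 := by linarith
  have h4 : q - p = 0 := real_inner_self_nonpos.mp h3
  exact (sub_eq_zero.mp h4).symm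

/-- `z̄ = (x̄, ȳ) ∈ K` is a `K`-restricted saddle point of `φ`. -/
def IsRestrictedSaddlePoint (φ : Space n m → ℝ) (K : Set (Space n m)) (z : Space n m) : Prop :=
  z ∈ K ∧ (∀ x, pt x (yPart z) ∈ K → φ (pt x (yPart z)) ≤ φ z) ∧
    (∀ y, pt (xPart z) y ∈ K → φ z ≤ φ (pt (xPart z) y))

/-- `z̄` is a `K`-restricted saddle point at which the first-order condition `f(z̄) ∈ N_K(z̄)` holds,
i.e. which is an equilibrium of the projected dynamics. The condition is automatic if `K` is a
product (`isRestrictedSaddlePoint_iff_stationary`), but not for a general convex set `K`. -/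
def IsStationarySaddlePoint (φ : Space n m → ℝ) (K : Set (Space n m)) (z : Space n m) : Prop :=
  IsRestrictedSaddlePoint φ K z ∧ gradField φ z ∈ normalCone K z

/-- `F` is a face of `K`: a convex subset of `K` that contains every segment of `K` whose relative
interior it meets. -/
def IsFace (K F : Set (Space n m)) : Prop :=
  Convex ℝ F ∧ IsExtreme ℝ K F

/-- `z` is a Carathéodory solution on `[0, ∞)` of `ż = v(z)`. -/
def IsCaratheodorySolution (v : Space n m → Space n m) (z : ℝ → Space n m) : Prop :=
  (∀ T : ℝ, 0 ≤ T → AbsolutelyContinuousOnInterval z 0 T) ∧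
    ∀ᵐ t ∂(volume.restrict (Ici (0 : ℝ))), HasDerivAt z (v (z t)) t

/-- The right-hand side `f(z) - P_{N_K(z)}(f(z))` of the subgradient method on `K`. -/
def subgradField (φ : Space n m → ℝ) (K : Set (Space n m)) (z : Space n m) : Space n m :=
  gradField φ z - proj (normalCone K z) (gradField φ z)

/-- The semi-flow `Φ` on `K` (a continuous action of the additive monoid `ℝ≥0`) is the subgradient
method on `K`: its trajectories are Carathéodory solutions of the projected gradient equation. -/
def IsSubgradientMethod (φ : Space n m → ℝ) (K : Set (Space n m)) (Φ : Flow ℝ≥0 K) : Prop :=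
  ∀ z₀ : K, IsCaratheodorySolution (subgradField φ K) fun t => (Φ t.toNNReal z₀ : Space n m)

/-- A semi-flow is globally convergent: the distance of every trajectory to the set of equilibrium
points tends to `0` (the distance to the empty set is `∞`). -/
def GloballyConvergent {X : Type*} [PseudoEMetricSpace X] (Φ : Flow ℝ≥0 X) : Prop :=
  ∀ x : X, Tendsto (fun t : ℝ≥0 => Metric.infEDist (Φ t x) {p | ∀ s : ℝ≥0, Φ s p = p}) atTop (𝓝 0)

/-- The subgradient method on `K` exists as a semi-flow on `K` and is globally convergent. -/
def SubgradientMethodConverges (φ : Space n m → ℝ) (K : Set (Space n m)) : Prop :=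
  ∃ Φ : Flow ℝ≥0 K, IsSubgradientMethod φ K Φ ∧ GloballyConvergent Φ

/-- On a product of convex sets every restricted saddle point satisfies the first-order
condition. -/
theorem isRestrictedSaddlePoint_iff_stationary {φ : Space n m → ℝ} (hφ : Differentiable ℝ φ)
    {A : Set (EuclideanSpace ℝ (Fin n))} {B : Set (EuclideanSpace ℝ (Fin m))}
    (hA : Convex ℝ A) (hB : Convex ℝ B) (z : Space n m) :
    IsRestrictedSaddlePoint φ {w | xPart w ∈ A ∧ yPart w ∈ B} z ↔
      IsStationarySaddlePoint φ {w | xPart w ∈ A ∧ yPart w ∈ B} z := by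
  refine ⟨fun h => ⟨h, ?_⟩, fun h => h.1⟩
  obtain ⟨⟨hzA, hzB⟩, hx, hy⟩ := h
  rintro v ⟨hvA, hvB⟩
  have dx : Differentiable ℝ fun x : EuclideanSpace ℝ (Fin n) => φ (pt x (yPart z)) := by
    refine hφ.comp (differentiable_euclidean.2 ?_)
    rintro (i | i)
    · exact (EuclideanSpace.proj (𝕜 := ℝ) i).differentiable
    · exact differentiable_const _
  have dy : Differentiable ℝ fun y : EuclideanSpace ℝ (Fin m) => φ (pt (xPart z) y) := by
    refine hφ.comp (differentiable_euclidean.2 ?_)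
    rintro (i | i)
    · exact differentiable_const _
    · exact (EuclideanSpace.proj (𝕜 := ℝ) i).differentiable
  have hpt : pt (xPart z) (yPart z) = z := by
    ext (i | i) <;> simp [pt, xPart, yPart]
  have h1 : inner ℝ (gradient (fun x => φ (pt x (yPart z))) (xPart z)) ((xPart v) - (xPart z)) ≤ 0 := by
    have hmax : IsMaxOn (fun x => φ (pt x (yPart z))) A (xPart z) := fun x hxA => by
      simpa [hpt] using hx x ⟨hxA, hzB⟩
    have := hmax.localize.hasFDerivWithinAt_nonpos
      (dx (xPart z)).hasGradientAt.hasFDerivAt.hasFDerivWithinAt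
      (sub_mem_posTangentConeAt_of_segment_subset (hA.segment_subset hzA hvA))
    simpa using this
  have h2 : 0 ≤ inner ℝ (gradient (fun y => φ (pt (xPart z) y)) (yPart z)) ((yPart v) - (yPart z)) := by
    have hmin : IsMinOn (fun y => φ (pt (xPart z) y)) B (yPart z) := fun y hyB => by
      simpa [hpt] using hy y ⟨hzA, hyB⟩
    have := hmin.localize.hasFDerivWithinAt_nonneg
      (dy (yPart z)).hasGradientAt.hasFDerivAt.hasFDerivWithinAt
      (sub_mem_posTangentConeAt_of_segment_subset (hB.segment_subset hzB hvB))
    simpa using this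
  have h3 : inner ℝ (gradField φ z) (v - z) =
      inner ℝ (gradient (fun x => φ (pt x (yPart z))) (xPart z)) ((xPart v) - (xPart z)) +
        inner ℝ (-gradient (fun y => φ (pt (xPart z) y)) (yPart z)) ((yPart v) - (yPart z)) := by
    simp only [gradField, PiLp.inner_apply, Fintype.sum_sum_type]
    simp [pt, xPart, yPart]
  rw [h3, inner_neg_left]
  linarith

end Subgradient

end

/-! Since `φ` is concave-convex, `f` is dissipative; normal cones are monotone, so the distance
between two solutions of `ẋ ∈ f(x) - N_K(x)` never increases (`IsSolution.norm_sub_le`). This gives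
uniqueness. Existence comes from a projected Euler scheme, a stationary saddle point `e` keeping
trajectories bounded (`exists_flow`). The resulting semi-flow `Φ` is nonexpansive and fixes `e`.

Let `W` be the limit set of one trajectory. It is non-empty, `Φ` maps it onto itself, and its points
are jointly recurrent, so `Φ` preserves distances within `W` and from `W` to `e`
(`dist_flow_eq_of_mapClusterPt`, `dist_flow_fixed_eq_of_mapClusterPt`). Constant distances leave no
slack in the dissipation inequality: for `z ∈ W` and almost every `t`, the normal vector `p = f - ż`
at `Φ t z` is orthogonal to `w - Φ t z` for every `w ∈ W ∪ {e}` (`IsSolution.inner_normal_eq_zero`).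
Hence the face of `K` exposed by `p` contains `W ∪ {e}`, and with it the smallest face `F` around
that set. So `p` is normal to the affine span of `F`, and on `W` the dynamics is the subgradient
method on that span (`isSolution_affineSpan_of_mapClusterPt`).

As `e ∈ F`, the hypothesis applies to `F`, and by uniqueness both semi-flows agree on `W`. A limit
point of the trajectory of some `z ∈ W` is then stationary and is also a limit point of the original
trajectory, which converges to it by nonexpansiveness. -/

section AbsolutelyContinuous

/-! ### Absolutely continuous functions -/

theorem AbsolutelyContinuousOnInterval.norm_comp {E : Type*} [NormedAddCommGroup E] {u : ℝ → E}
    {a b : ℝ} (hu : AbsolutelyContinuousOnInterval u a b) :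
    AbsolutelyContinuousOnInterval (fun t => ‖u t‖) a b := by
  rw [absolutelyContinuousOnInterval_iff] at hu ⊢
  intro ε hε
  obtain ⟨δ, hδ, h⟩ := hu ε hε
  refine ⟨δ, hδ, fun I hI hlen => (Finset.sum_le_sum fun i _ => ?_).trans_lt (h I hI hlen)⟩
  rw [Real.dist_eq, dist_eq_norm]
  exact abs_norm_sub_norm_le _ _

theorem AbsolutelyContinuousOnInterval.le_of_ae_hasDerivAt_nonpos {g : ℝ → ℝ} {a b : ℝ}
    (hab : a ≤ b) (hg : AbsolutelyContinuousOnInterval g a b)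
    (h : ∀ᵐ t, a < t → ∃ d ≤ 0, HasDerivAt g d t) : g b ≤ g a := by
  have h1 := hg.integral_deriv_eq_sub
  have h2 : 0 ≤ ∫ t in a..b, -deriv g t := by
    refine intervalIntegral.integral_nonneg_of_ae_restrict hab ?_
    -- The derivative is controlled only for `a < t`; the endpoint is a null set.
    rw [Measure.restrict_congr_set Ioc_ae_eq_Icc.symm]
    refine (ae_restrict_iff' measurableSet_Ioc).2 (h.mono fun t ht hmem => ?_)
    obtain ⟨d, hd, hgd⟩ := ht hmem.1
    simpa [hgd.deriv] using hd
  rw [intervalIntegral.integral_neg, h1] at h2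
  linarith

end AbsolutelyContinuous

namespace Subgradient

variable {n m : ℕ}

/-! ### Normal cones and nearest points -/

section NormalCone

variable {C : Set (Space n m)} {z w u p : Space n m}

theorem zero_mem_normalCone : (0 : Space n m) ∈ normalCone C z := fun v _ => by simp

theorem convex_normalCone : Convex ℝ (normalCone C z) := by
  intro a ha b hb s t hs ht _ v hv
  rw [inner_add_left, real_inner_smul_left, real_inner_smul_left]
  have h1 := mul_nonpos_of_nonneg_of_nonpos hs (ha v hv)
  have h2 := mul_nonpos_of_nonneg_of_nonpos ht (hb v hv)
  linarith

theorem isClosed_normalCone : IsClosed (normalCone C z) := by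
  have : normalCone C z = ⋂ v ∈ C, {w | inner ℝ w (v - z) ≤ 0} := by
    ext w; simp [normalCone]
  rw [this]
  exact isClosed_biInter fun v _ =>
    isClosed_le (continuous_id.inner continuous_const) continuous_const

theorem proj_normalCone_mem : proj (normalCone C z) u ∈ normalCone C z :=
  (proj_spec ⟨0, zero_mem_normalCone⟩ isClosed_normalCone convex_normalCone u).1

theorem gradField_sub_subgradField_mem (φ : Space n m → ℝ) :
    gradField φ z - subgradField φ C z ∈ normalCone C z := by
  rw [subgradField, sub_sub_cancel]
  exact proj_normalCone_mem

/-- The obtuse angle criterion for the nearest point. -/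
theorem inner_sub_proj_nonpos (hne : C.Nonempty) (hcl : IsClosed C) (hC : Convex ℝ C)
    (u : Space n m) (hw : w ∈ C) : inner ℝ (u - proj C u) (w - proj C u) ≤ 0 := by
  obtain ⟨hq, hqm⟩ := proj_spec hne hcl hC u
  have h := (norm_eq_iInf_iff_real_inner_le_zero hC hq (u := u)).1 ?_
  · exact h w hw
  · have : Nonempty C := ⟨⟨w, hw⟩⟩
    refine le_antisymm (le_ciInf fun w => hqm w w.2) ?_
    exact ciInf_le (f := fun w : C => ‖u - w‖) ⟨0, by rintro _ ⟨w, rfl⟩; exact norm_nonneg _⟩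
      ⟨_, hq⟩

theorem norm_proj_sub_le (hne : C.Nonempty) (hcl : IsClosed C) (hC : Convex ℝ C)
    (u : Space n m) (hw : w ∈ C) : ‖proj C u - w‖ ≤ ‖u - w‖ := by
  have h := inner_sub_proj_nonpos hne hcl hC u hw
  have e : u - w = (u - proj C u) + (proj C u - w) := by abel
  have e2 : inner ℝ (u - proj C u) (proj C u - w) = -inner ℝ (u - proj C u) (w - proj C u) := by
    rw [← inner_neg_right, neg_sub]
  have h3 := norm_add_sq_real (u - proj C u) (proj C u - w)
  rw [← e, e2] at h3
  refine le_of_sq_le_sq ?_ (norm_nonneg _)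
  nlinarith [sq_nonneg ‖u - proj C u‖]

/-- The velocity of a curve in `C` is orthogonal to the normal cone. -/
theorem inner_velocity_eq_zero {x : ℝ → Space n m} {t : ℝ} {d : Space n m}
    (hx : ∀ᶠ s in 𝓝 t, x s ∈ C) (hd : HasDerivAt x d t) (hp : p ∈ normalCone C (x t)) :
    inner ℝ p d = 0 := by
  have h1 : HasDerivAt (fun s => inner ℝ p (x s - x t)) (inner ℝ p d) t := by
    simpa using (hasDerivAt_const t p).inner ℝ (hd.sub_const (x t))
  have h2 : IsLocalMax (fun s => inner ℝ p (x s - x t)) t := by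
    filter_upwards [hx] with s hs
    simpa using hp (x s) hs
  exact h2.hasDerivAt_eq_zero h1

/-- A velocity that differs from `f` by a normal vector is the right-hand side of the subgradient
method. -/
theorem subgradField_eq_of_hasDerivAt (φ : Space n m → ℝ) {x : ℝ → Space n m} {t : ℝ}
    {d : Space n m} (hx : ∀ᶠ s in 𝓝 t, x s ∈ C) (hd : HasDerivAt x d t)
    (hp : gradField φ (x t) - d ∈ normalCone C (x t)) : subgradField φ C (x t) = d := by
  have h : gradField φ (x t) - d = proj (normalCone C (x t)) (gradField φ (x t)) := by
    refine eq_proj convex_normalCone hp fun c hc => ?_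
    -- The velocity `d` is orthogonal to every normal vector, so Pythagoras shows that `f - d` is
    -- the nearest point of the cone.
    have h0 : inner ℝ d (gradField φ (x t) - d - c) = 0 := by
      rw [inner_sub_right, real_inner_comm, real_inner_comm c d, inner_velocity_eq_zero hx hd hp,
        inner_velocity_eq_zero hx hd hc, sub_zero]
    have h1 := norm_add_sq_real d (gradField φ (x t) - d - c)
    rw [h0] at h1
    have e : d + (gradField φ (x t) - d - c) = gradField φ (x t) - c := by abel
    rw [e] at h1
    rw [sub_sub_cancel]
    refine le_of_sq_le_sq ?_ (norm_nonneg _)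
    nlinarith [sq_nonneg ‖gradField φ (x t) - d - c‖]
  rw [subgradField, ← h, sub_sub_cancel]

end NormalCone

/-! ### Solutions of the projected dynamics -/

section Solution

/-- The vector field `f` is dissipative: its negative is monotone. -/
def Dissipative (f : Space n m → Space n m) : Prop :=
  ∀ z w, inner ℝ (f z - f w) (z - w) ≤ 0

/-- `x` solves the differential inclusion `ẋ ∈ f(x) - N_C(x)` on `[0, ∞)`. -/
structure IsSolution (f : Space n m → Space n m) (C : Set (Space n m)) (x : ℝ → Space n m) :
    Prop where
  ac : ∀ T : ℝ, 0 ≤ T → AbsolutelyContinuousOnInterval x 0 T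
  mem : ∀ t : ℝ, 0 ≤ t → x t ∈ C
  ae_deriv : ∀ᵐ t : ℝ, 0 < t → ∃ d, HasDerivAt x d t ∧ f (x t) - d ∈ normalCone C (x t)

variable {f : Space n m → Space n m} {C : Set (Space n m)} {x y : ℝ → Space n m} {φ : Space n m → ℝ}

theorem HasDerivAt.norm_sub_sq {t : ℝ} {d e : Space n m} (hx : HasDerivAt x d t)
    (hy : HasDerivAt y e t) :
    HasDerivAt (fun s => ‖x s - y s‖ ^ 2) (2 * inner ℝ (d - e) (x t - y t)) t := by
  have := (hx.sub hy).norm_sq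
  rw [real_inner_comm] at this
  exact this

/-- Testing each normal vector against the other point adds two terms of the right sign to the
dissipativity of `f`. -/
theorem inner_velocity_sub_nonpos (hf : Dissipative f) {z w d e : Space n m} (hz : z ∈ C)
    (hw : w ∈ C) (hd : f z - d ∈ normalCone C z) (he : f w - e ∈ normalCone C w) :
    inner ℝ (d - e) (z - w) ≤ 0 := by
  have h1 := hd w hw
  have h2 := he z hz
  have h3 := hf z w
  rw [← neg_sub z w, inner_neg_right] at h1
  have e : d - e = (f z - f w) - (f z - d) + (f w - e) := by abel
  rw [e, inner_add_left, inner_sub_left]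
  linarith

/-- The distance of two solutions is nonincreasing. -/
theorem IsSolution.norm_sub_le (hf : Dissipative f) (hx : IsSolution f C x)
    (hy : IsSolution f C y) {s t : ℝ} (hs : 0 ≤ s) (hst : s ≤ t) :
    ‖x t - y t‖ ≤ ‖x s - y s‖ := by
  have hac : AbsolutelyContinuousOnInterval (fun r => ‖x r - y r‖ ^ 2) s t := by
    have h := ((hx.ac t (hs.trans hst)).fun_sub (hy.ac t (hs.trans hst))).norm_comp
    have h' := (h.fun_mul h).mono (c := s) (d := t) (by
      rw [uIcc_of_le hst, uIcc_of_le (hs.trans hst)]; exact Icc_subset_Icc_left hs)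
    simpa only [pow_two] using h'
  refine le_of_sq_le_sq ?_ (norm_nonneg _)
  refine hac.le_of_ae_hasDerivAt_nonpos hst ?_
  filter_upwards [hx.ae_deriv, hy.ae_deriv] with r hxr hyr hr
  obtain ⟨d, hd, hdn⟩ := hxr (hs.trans_lt hr)
  obtain ⟨e, he, hen⟩ := hyr (hs.trans_lt hr)
  refine ⟨_, ?_, HasDerivAt.norm_sub_sq hd he⟩
  have := inner_velocity_sub_nonpos hf (hx.mem r (hs.trans hr.le)) (hy.mem r (hs.trans hr.le))
    hdn hen
  linarith

theorem IsSolution.eq_of_eq_zero (hf : Dissipative f) (hx : IsSolution f C x)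
    (hy : IsSolution f C y) (h0 : x 0 = y 0) {t : ℝ} (ht : 0 ≤ t) : x t = y t := by
  have h := hx.norm_sub_le hf hy le_rfl ht
  rw [h0, sub_self, norm_zero] at h
  exact sub_eq_zero.1 (norm_le_zero_iff.1 h)

theorem isSolution_of_isCaratheodorySolution (hx : IsCaratheodorySolution (subgradField φ C) x)
    (hmem : ∀ t : ℝ, 0 ≤ t → x t ∈ C) : IsSolution (gradField φ) C x where
  ac := hx.1
  mem := hmem
  ae_deriv := by
    filter_upwards [(ae_restrict_iff' measurableSet_Ici).1 hx.2] with t ht h0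
    exact ⟨_, ht (mem_Ici.2 h0.le), gradField_sub_subgradField_mem φ⟩

/-- The inclusion loses nothing: at a positive time of differentiability the curve stays in `C` on
both sides, which forces the velocity to be `f` minus its projection. -/
theorem IsSolution.isCaratheodorySolution (hx : IsSolution (gradField φ) C x) :
    IsCaratheodorySolution (subgradField φ C) x := by
  refine ⟨hx.ac, ?_⟩
  rw [Measure.restrict_congr_set Ioi_ae_eq_Ici.symm, ae_restrict_iff' measurableSet_Ioi]
  filter_upwards [hx.ae_deriv] with t ht h0
  obtain ⟨d, hd, hdn⟩ := ht h0
  have hmem : ∀ᶠ s in 𝓝 t, x s ∈ C := by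
    filter_upwards [Ioi_mem_nhds h0] with s hs using hx.mem s (le_of_lt hs)
  rwa [subgradField_eq_of_hasDerivAt φ hmem hd hdn]

theorem isSolution_const {z : Space n m} (hz : z ∈ C) (hfz : f z ∈ normalCone C z) :
    IsSolution f C fun _ => z where
  ac T _ := (LipschitzWith.const z).lipschitzOnWith.absolutelyContinuousOnInterval
  mem _ _ := hz
  ae_deriv := Eventually.of_forall fun t _ => ⟨0, hasDerivAt_const t z, by simpa using hfz⟩

end Solution

/-! ### The gradient field of a concave-convex function -/

section GradField

/-- Restriction to the line through `x` and `y` reduces this to the slope inequality in one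
variable. -/
theorem ConvexOn.inner_gradient_le {E : Type*} [NormedAddCommGroup E] [InnerProductSpace ℝ E]
    [CompleteSpace E] {g : E → ℝ} (hg : ConvexOn ℝ univ g) {x : E} (hd : DifferentiableAt ℝ g x)
    (y : E) : g x + inner ℝ (gradient g x) (y - x) ≤ g y := by
  have hc : ConvexOn ℝ univ fun t : ℝ => g (AffineMap.lineMap x y t) := by
    simpa using! hg.comp_affineMap (AffineMap.lineMap x y : ℝ →ᵃ[ℝ] E)
  have h0 : (AffineMap.lineMap x y : ℝ →ᵃ[ℝ] E) 0 = x := by simp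
  have hder : HasDerivAt (fun t : ℝ => g (AffineMap.lineMap x y t))
      (inner ℝ (gradient g x) (y - x)) 0 := by
    have h1 : HasFDerivAt g _ ((AffineMap.lineMap x y : ℝ →ᵃ[ℝ] E) 0) :=
      h0.symm ▸ hd.hasGradientAt.hasFDerivAt
    simpa using! h1.comp_hasDerivAt (0 : ℝ) (AffineMap.hasDerivAt_lineMap (a := x) (b := y) (x := 0))
  have h := hc.le_slope_of_hasDerivAt (mem_univ 0) (mem_univ 1) zero_lt_one hder
  rw [slope_def_field] at h
  simp only [AffineMap.lineMap_apply_one, AffineMap.lineMap_apply_zero, sub_zero, div_one] at h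
  linarith

@[simp] theorem xPart_pt (x : EuclideanSpace ℝ (Fin n)) (y : EuclideanSpace ℝ (Fin m)) :
    xPart (pt x y) = x := by ext i; simp [pt, xPart]

@[simp] theorem yPart_pt (x : EuclideanSpace ℝ (Fin n)) (y : EuclideanSpace ℝ (Fin m)) :
    yPart (pt x y) = y := by ext i; simp [pt, yPart]

@[simp] theorem pt_xPart_yPart (z : Space n m) : pt (xPart z) (yPart z) = z := by
  ext (i | i) <;> simp [pt, xPart, yPart]

theorem xPart_sub (z w : Space n m) : xPart (z - w) = xPart z - xPart w := by
  ext i; simp [xPart]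

theorem yPart_sub (z w : Space n m) : yPart (z - w) = yPart z - yPart w := by
  ext i; simp [yPart]

theorem inner_pt_left (a : EuclideanSpace ℝ (Fin n)) (b : EuclideanSpace ℝ (Fin m))
    (v : Space n m) : inner ℝ (pt a b) v = inner ℝ a (xPart v) + inner ℝ b (yPart v) := by
  simp only [PiLp.inner_apply, Fintype.sum_sum_type]
  simp [pt, xPart, yPart]

theorem differentiable_pt_left (y : EuclideanSpace ℝ (Fin m)) :
    Differentiable ℝ fun x : EuclideanSpace ℝ (Fin n) => pt x y := by
  refine differentiable_euclidean.2 ?_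
  rintro (i | i)
  · exact (EuclideanSpace.proj (𝕜 := ℝ) i).differentiable
  · exact differentiable_const _

theorem differentiable_pt_right (x : EuclideanSpace ℝ (Fin n)) :
    Differentiable ℝ fun y : EuclideanSpace ℝ (Fin m) => pt x y := by
  refine differentiable_euclidean.2 ?_
  rintro (i | i)
  · exact differentiable_const _
  · exact (EuclideanSpace.proj (𝕜 := ℝ) i).differentiable

variable {φ : Space n m → ℝ}

/-- Minus the gradient field of a differentiable concave-convex function is monotone. -/
theorem dissipative_gradField (hφ : Differentiable ℝ φ) (hcc : ConcaveConvex φ) :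
    Dissipative (gradField φ) := by
  have hx : ∀ (y : EuclideanSpace ℝ (Fin m)) (x x' : EuclideanSpace ℝ (Fin n)),
      φ (pt x' y) ≤ φ (pt x y) + inner ℝ (gradient (fun x => φ (pt x y)) x) (x' - x) := by
    intro y x x'
    have hd : DifferentiableAt ℝ (fun x => φ (pt x y)) x :=
      (hφ.comp (differentiable_pt_left y)) x
    have h := ConvexOn.inner_gradient_le (hcc.1 y).neg hd.neg x'
    have e : gradient (-fun x => φ (pt x y)) x = -gradient (fun x => φ (pt x y)) x := by
      refine HasGradientAt.gradient ?_
      rw [hasGradientAt_iff_hasFDerivAt, map_neg]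
      exact hd.hasGradientAt.hasFDerivAt.neg
    rw [e, inner_neg_left] at h
    simp only [Pi.neg_apply] at h
    linarith
  have hy : ∀ (x : EuclideanSpace ℝ (Fin n)) (y y' : EuclideanSpace ℝ (Fin m)),
      φ (pt x y) + inner ℝ (gradient (fun y => φ (pt x y)) y) (y' - y) ≤ φ (pt x y') :=
    fun x y y' => ConvexOn.inner_gradient_le (hcc.2 x) ((hφ.comp (differentiable_pt_right x)) y) y'
  intro z w
  have h1 := hx (yPart z) (xPart z) (xPart w)
  have h2 := hx (yPart w) (xPart w) (xPart z)
  have h3 := hy (xPart z) (yPart z) (yPart w)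
  have h4 := hy (xPart w) (yPart w) (yPart z)
  rw [inner_sub_left, gradField, gradField, inner_pt_left, inner_pt_left, xPart_sub, yPart_sub,
    inner_neg_left, inner_neg_left]
  rw [← neg_sub (xPart z) (xPart w), inner_neg_right] at h1
  rw [← neg_sub (yPart z) (yPart w), inner_neg_right] at h3
  linarith

/-- Expressing the partial gradients through the full derivative makes the continuity of `f` a
consequence of that of `fderiv`. -/
theorem inner_gradField (hφ : Differentiable ℝ φ) (z v : Space n m) :
    inner ℝ (gradField φ z) v = fderiv ℝ φ z (pt (xPart v) (-yPart v)) := by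
  have key : ∀ {E : Type} [NormedAddCommGroup E] [InnerProductSpace ℝ E] [CompleteSpace E]
      (g : E → Space n m) (x d : E) (e : Space n m), Differentiable ℝ g → g x = z →
      (∀ t : ℝ, g (x + t • d) = z + t • e) →
      inner ℝ (gradient (fun x => φ (g x)) x) d = fderiv ℝ φ z e := by
    intro E _ _ _ g x d e hg hz hl
    have h1 : HasDerivAt (fun t : ℝ => φ (g (x + t • d)))
        (inner ℝ (gradient (fun x => φ (g x)) x) d) 0 := by
      have h := (hφ.comp hg x).hasGradientAt.hasFDerivAt
      have hl : HasDerivAt (fun t : ℝ => x + t • d) d 0 := by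
        simpa using ((hasDerivAt_id (0 : ℝ)).smul_const d).const_add x
      rw [show x = x + (0 : ℝ) • d by simp] at h
      have h' := h.comp_hasDerivAt (0 : ℝ) hl
      simpa using! h'
    have h2 : HasDerivAt (fun t : ℝ => φ (z + t • e)) (fderiv ℝ φ z e) 0 := by
      have hl : HasDerivAt (fun t : ℝ => z + t • e) e 0 := by
        simpa using ((hasDerivAt_id (0 : ℝ)).smul_const e).const_add z
      have h' : HasFDerivAt φ (fderiv ℝ φ z) (z + (0 : ℝ) • e) := by
        simpa using! (hφ z).hasFDerivAt
      exact h'.comp_hasDerivAt (0 : ℝ) hl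
    simp only [hl] at h1
    exact h1.unique h2
  have hx := key (fun x => pt x (yPart z)) (xPart z) (xPart v) (pt (xPart v) 0)
    (differentiable_pt_left _) (by simp) (fun t => by
      ext (i | i) <;> simp [pt, xPart, yPart])
  have hy := key (fun y => pt (xPart z) y) (yPart z) (yPart v) (pt 0 (yPart v))
    (differentiable_pt_right _) (by simp) (fun t => by
      ext (i | i) <;> simp [pt, xPart, yPart])
  have e : pt (xPart v) (-yPart v) = pt (xPart v) 0 - pt 0 (yPart v) := by
    ext (i | i) <;> simp [pt, xPart, yPart]
  rw [gradField, inner_pt_left, inner_neg_left, hx, hy, e, map_sub, sub_eq_add_neg]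

theorem continuous_gradField (hφ : ContDiff ℝ 1 φ) : Continuous (gradField φ) := by
  have hd : Differentiable ℝ φ := hφ.differentiable one_ne_zero
  rw [(PiLp.homeomorph 2 fun _ : Fin n ⊕ Fin m => ℝ).isInducing.continuous_iff]
  refine continuous_pi fun i => ?_
  have : (fun z => gradField φ z i) = fun z => fderiv ℝ φ z
      (pt (xPart (EuclideanSpace.single i (1 : ℝ))) (-yPart (EuclideanSpace.single i (1 : ℝ)))) := by
    ext z
    rw [← inner_gradField hd, EuclideanSpace.inner_single_right]
    simp
  exact this ▸ (hφ.continuous_fderiv one_ne_zero).clm_apply continuous_const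

end GradField

/-! ### The projected Euler scheme -/

section Euler

variable {f : Space n m → Space n m} {K : Set (Space n m)} {z₀ : Space n m} {h M : ℝ}

/-- The projected Euler scheme with step `h`. -/
noncomputable def euler (f : Space n m → Space n m) (K : Set (Space n m)) (z₀ : Space n m) (h : ℝ) :
    ℕ → Space n m
  | 0 => z₀
  | k + 1 => proj K (euler f K z₀ h k + h • f (euler f K z₀ h k))

theorem euler_mem (hcl : IsClosed K) (hK : Convex ℝ K) (hz₀ : z₀ ∈ K) (k : ℕ) :
    euler f K z₀ h k ∈ K := by
  cases k with
  | zero => exact hz₀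
  | succ k => exact (proj_spec ⟨z₀, hz₀⟩ hcl hK _).1

theorem euler_step (hcl : IsClosed K) (hK : Convex ℝ K) (hz₀ : z₀ ∈ K) {v : Space n m}
    (hv : v ∈ K) (k : ℕ) :
    ‖euler f K z₀ h (k + 1) - v‖ ≤ ‖euler f K z₀ h k + h • f (euler f K z₀ h k) - v‖ :=
  norm_proj_sub_le ⟨z₀, hz₀⟩ hcl hK _ hv

theorem norm_euler_sub_le (hcl : IsClosed K) (hK : Convex ℝ K) (hz₀ : z₀ ∈ K) (hh : 0 ≤ h)
    (hM : ∀ z ∈ K, ‖f z‖ ≤ M) (k j : ℕ) :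
    ‖euler f K z₀ h (k + j) - euler f K z₀ h k‖ ≤ j * h * M := by
  induction j with
  | zero => simp
  | succ j ih =>
    have h1 := euler_step (f := f) (h := h) hcl hK hz₀
      (euler_mem (f := f) (h := h) hcl hK hz₀ (k + j)) (k + j)
    rw [add_sub_cancel_left, norm_smul, Real.norm_of_nonneg hh] at h1
    have h2 := mul_le_mul_of_nonneg_left
      (hM _ (euler_mem (f := f) (h := h) hcl hK hz₀ (k + j))) hh
    have h3 := norm_sub_le_norm_sub_add_norm_sub (euler f K z₀ h (k + j + 1))
      (euler f K z₀ h (k + j)) (euler f K z₀ h k)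
    rw [← add_assoc]
    push_cast
    linarith

/-- One-sided growth estimate for the squared distance along the projected Euler scheme, while the
drift towards `v` is at most `G`. -/
theorem sq_norm_euler_sub_le (hcl : IsClosed K) (hK : Convex ℝ K) (hz₀ : z₀ ∈ K) (hh : 0 ≤ h)
    (hM : ∀ z ∈ K, ‖f z‖ ≤ M) {v : Space n m} (hv : v ∈ K) {G : ℝ} (k j : ℕ)
    (hG : ∀ i < j, inner ℝ (f (euler f K z₀ h (k + i))) (euler f K z₀ h (k + i) - v) ≤ G) :
    ‖euler f K z₀ h (k + j) - v‖ ^ 2 ≤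
      ‖euler f K z₀ h k - v‖ ^ 2 + j * h * (2 * G + h * M ^ 2) := by
  induction j with
  | zero => simp
  | succ j ih =>
    have ih := ih fun i hi => hG i (hi.trans (Nat.lt_succ_self j))
    have h1 := euler_step (f := f) (h := h) hcl hK hz₀ hv (k + j)
    have h2 := hM _ (euler_mem (f := f) (h := h) hcl hK hz₀ (k + j))
    have h3 := hG j (Nat.lt_succ_self j)
    rw [← add_assoc]
    generalize euler f K z₀ h (k + j + 1) = b at *
    generalize euler f K z₀ h (k + j) = a at *
    have h4 : ‖b - v‖ ^ 2 ≤ ‖a + h • f a - v‖ ^ 2 := pow_le_pow_left₀ (norm_nonneg _) h1 2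
    have h5 := norm_add_sq_real (h • f a) (a - v)
    rw [show h • f a + (a - v) = a + h • f a - v by abel, real_inner_smul_left, norm_smul,
      Real.norm_of_nonneg hh, mul_pow] at h5
    have h6 : ‖f a‖ ^ 2 ≤ M ^ 2 := pow_le_pow_left₀ (norm_nonneg _) h2 2
    have h7 := mul_le_mul_of_nonneg_left h6 (sq_nonneg h)
    have h8 := mul_le_mul_of_nonneg_left h3 hh
    push_cast
    nlinarith

end Euler

/-! ### Existence of solutions -/

section Existence

variable {f : Space n m → Space n m} {K : Set (Space n m)} {z₀ : Space n m}

theorem floor_sub_floor_le {a s t : ℝ} (ha : 0 ≤ a) (hst : s ≤ t) :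
    ((⌊a * t⌋₊ - ⌊a * s⌋₊ : ℕ) : ℝ) ≤ a * (t - s) + 1 := by
  have h1 : a * s ≤ a * t := mul_le_mul_of_nonneg_left hst ha
  rw [Nat.cast_sub (Nat.floor_mono h1)]
  have h2 := Nat.sub_one_lt_floor (a * s)
  rcases le_total 0 (a * t) with h | h
  · have := Nat.floor_le h
    linarith
  · rw [Nat.floor_of_nonpos h]
    have : (0 : ℝ) ≤ (⌊a * s⌋₊ : ℝ) := Nat.cast_nonneg _
    push_cast
    linarith

theorem tendsto_floor_sub_floor {s t : ℝ} (hs : 0 ≤ s) (hst : s ≤ t) :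
    Tendsto (fun N : ℕ => ((⌊((N : ℝ) + 1) * t⌋₊ - ⌊((N : ℝ) + 1) * s⌋₊ : ℕ) : ℝ) *
      (1 / ((N : ℝ) + 1))) atTop (𝓝 (t - s)) := by
  have h0 := tendsto_one_div_add_atTop_nhds_zero_nat (𝕜 := ℝ)
  refine tendsto_of_tendsto_of_tendsto_of_le_of_le (g := fun N : ℕ => t - s - 1 / ((N : ℝ) + 1))
    (h := fun N : ℕ => t - s + 1 / ((N : ℝ) + 1)) (by simpa using h0.const_sub (t - s))
    (by simpa using h0.const_add (t - s)) (fun N => ?_) (fun N => ?_)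
  · have hN : (0 : ℝ) < (N : ℝ) + 1 := by positivity
    have h1 : ((N : ℝ) + 1) * s ≤ ((N : ℝ) + 1) * t := mul_le_mul_of_nonneg_left hst hN.le
    have h2 := Nat.sub_one_lt_floor (((N : ℝ) + 1) * t)
    have h3 := Nat.floor_le (mul_nonneg hN.le hs)
    simp only
    rw [Nat.cast_sub (Nat.floor_mono h1), mul_one_div, le_div_iff₀ hN, sub_mul,
      one_div_mul_cancel hN.ne']
    linarith
  · have hN : (0 : ℝ) < (N : ℝ) + 1 := by positivity
    have := floor_sub_floor_le hN.le hst
    simp only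
    rw [mul_one_div, div_le_iff₀ hN, add_mul (t - s), one_div_mul_cancel hN.ne']
    linarith

/-- Existence for the projected dynamics of a continuous field on a compact convex set. -/
theorem exists_curve_of_isCompact (hf : Continuous f) (hc : IsCompact K) (hK : Convex ℝ K)
    (hz₀ : z₀ ∈ K) : ∃ (M : ℝ≥0) (x : ℝ → Space n m), LipschitzWith M x ∧ x 0 = z₀ ∧
      (∀ t, x t ∈ K) ∧
      ∀ t > 0, ∀ d, HasDerivAt x d t → f (x t) - d ∈ normalCone K (x t) := by
  obtain ⟨M₀, hM₀⟩ := hc.exists_bound_of_continuousOn hf.continuousOn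
  obtain ⟨M, hM, hMpos⟩ : ∃ M : ℝ, (∀ z ∈ K, ‖f z‖ ≤ M) ∧ 0 < M :=
    -- The bound is made positive because `r / (4 * M)` occurs below.
    ⟨max M₀ 1, fun z hz => (hM₀ z hz).trans (le_max_left _ _), zero_lt_one.trans_le (le_max_right _ _)⟩
  have hcl := hc.isClosed
  set h : ℕ → ℝ := fun N => 1 / ((N : ℝ) + 1)
  have hh : ∀ N, 0 < h N := fun N => by positivity
  have hhN : ∀ N : ℕ, h N * ((N : ℝ) + 1) = 1 := fun N =>
    one_div_mul_cancel (by positivity)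
  set a : ℕ → ℕ → Space n m := fun N => euler f K z₀ (h N)
  have ha : ∀ N k, a N k ∈ K := fun N k => euler_mem hcl hK hz₀ k
  set k : ℕ → ℝ → ℕ := fun N t => ⌊((N : ℝ) + 1) * t⌋₊
  have hk : ∀ N {s t : ℝ}, s ≤ t → k N s ≤ k N t := fun N s t hst =>
    Nat.floor_mono (mul_le_mul_of_nonneg_left hst (by positivity))
  -- A limit along a free ultrafilter exists at all times simultaneously by compactness, so no
  -- subsequence has to be extracted.
  let U : Ultrafilter ℕ := hyperfilter ℕ
  have hU : (U : Filter ℕ) ≤ atTop := by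
    rw [← Nat.cofinite_eq_atTop]; exact hyperfilter_le_cofinite
  have hlim : ∀ t, ∃ p ∈ K, Tendsto (fun N => a N (k N t)) U (𝓝 p) := fun t => by
    obtain ⟨p, hp, hle⟩ := hc.ultrafilter_le_nhds (U.map fun N => a N (k N t))
      (le_principal_iff.2 (Ultrafilter.mem_map.2 (univ_mem' fun N => ha _ _)))
    exact ⟨p, hp, hle⟩
  choose x hxK hx using hlim
  have hh0 : Tendsto h U (𝓝 0) := (tendsto_one_div_add_atTop_nhds_zero_nat (𝕜 := ℝ)).mono_left hU
  have hcount : ∀ N {s t : ℝ}, s ≤ t →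
      ((k N t - k N s : ℕ) : ℝ) * h N ≤ t - s + h N := fun N s t hst => by
    have h1 := floor_sub_floor_le (a := (N : ℝ) + 1) (by positivity) hst
    calc ((k N t - k N s : ℕ) : ℝ) * h N ≤ (((N : ℝ) + 1) * (t - s) + 1) * h N :=
          mul_le_mul_of_nonneg_right h1 (hh N).le
      _ = (h N * ((N : ℝ) + 1)) * (t - s) + h N := by ring
      _ = t - s + h N := by rw [hhN, one_mul]
  have hdist : ∀ {s t : ℝ}, s ≤ t → ‖x t - x s‖ ≤ M * (t - s) := fun {s t} hst => by
    have h1 : Tendsto (fun N => (t - s + h N) * M) U (𝓝 ((t - s) * M)) := by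
      simpa using (hh0.const_add (t - s)).mul_const M
    rw [mul_comm]
    refine le_of_tendsto_of_tendsto ((hx t).sub (hx s)).norm h1 (Eventually.of_forall fun N => ?_)
    have h2 := norm_euler_sub_le (f := f) hcl hK hz₀ (hh N).le hM (k N s) (k N t - k N s)
    rw [Nat.add_sub_cancel' (hk N hst)] at h2
    exact h2.trans (mul_le_mul_of_nonneg_right (hcount N hst) hMpos.le)
  refine ⟨M.toNNReal, x, ?_, ?_, hxK, ?_⟩
  · refine LipschitzWith.of_dist_le_mul fun s t => ?_
    rw [Real.coe_toNNReal M hMpos.le]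
    rcases le_total s t with hst | hst
    · rw [dist_comm, dist_eq_norm, dist_comm s, Real.dist_eq, abs_of_nonneg (sub_nonneg.2 hst)]
      exact hdist hst
    · rw [dist_eq_norm, Real.dist_eq, abs_of_nonneg (sub_nonneg.2 hst)]
      exact hdist hst
  · have h1 : Tendsto (fun N => a N (k N 0)) U (𝓝 z₀) := by
      have : (fun N => a N (k N 0)) = fun _ => z₀ := by
        ext1 N
        simp [a, k, euler]
      rw [this]
      exact tendsto_const_nhds
    exact tendsto_nhds_unique (hx 0) h1
  · intro t ht d hd v hv
    -- The growth of `‖x - v‖ ^ 2` along the scheme bounds its right derivative at `t`; the slack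
    -- `ε` makes the drift bound hold on a whole ball around `x t`.
    have key : ∀ ε > 0, inner ℝ d (x t - v) ≤ inner ℝ (f (x t)) (x t - v) + ε := by
      intro ε hε
      set G := inner ℝ (f (x t)) (x t - v) + ε
      have hcont : Continuous fun w => inner ℝ (f w) (w - v) :=
        hf.inner (continuous_id.sub continuous_const)
      obtain ⟨r, hr, hball⟩ := Metric.eventually_nhds_iff.1
        (hcont.continuousAt.eventually (gt_mem_nhds (show _ < G from lt_add_of_pos_right _ hε)))
      have hest : ∀ᶠ δ : ℝ in 𝓝[>] 0, ‖x (t + δ) - v‖ ^ 2 - ‖x t - v‖ ^ 2 ≤ δ * (2 * G) := by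
        -- Of the radius `r`, a quarter each is allotted to `δ * M`, to `h N * M` and to the
        -- distance from `a N (k N t)` to `x t`, so the iterates used stay in the ball.
        have hδ : ∀ᶠ δ : ℝ in 𝓝[>] 0, δ < r / (4 * M) :=
          nhdsWithin_le_nhds (gt_mem_nhds (by positivity))
        filter_upwards [hδ, self_mem_nhdsWithin] with δ hδr hδ0
        have hδ0 : 0 < δ := hδ0
        rw [lt_div_iff₀ (by positivity)] at hδr
        have htδ : t ≤ t + δ := by linarith
        have hcnt : Tendsto (fun N => ((k N (t + δ) - k N t : ℕ) : ℝ) * h N) U (𝓝 δ) := by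
          have := (tendsto_floor_sub_floor ht.le htδ).mono_left hU
          rwa [add_sub_cancel_left] at this
        have hrhs : Tendsto (fun N => ‖a N (k N t) - v‖ ^ 2 +
            ((k N (t + δ) - k N t : ℕ) : ℝ) * h N * (2 * G + h N * M ^ 2)) U
            (𝓝 (‖x t - v‖ ^ 2 + δ * (2 * G + 0 * M ^ 2))) :=
          (((hx t).sub_const v).norm.pow 2).add
            (hcnt.mul ((hh0.mul_const _).const_add _))
        rw [zero_mul, add_zero] at hrhs
        rw [sub_le_iff_le_add']
        refine le_of_tendsto_of_tendsto (((hx (t + δ)).sub_const v).norm.pow 2) hrhs ?_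
        have hev1 : ∀ᶠ N in (U : Filter ℕ), dist (a N (k N t)) (x t) < r / 4 :=
          (hx t).eventually (Metric.ball_mem_nhds _ (by positivity))
        have hev2 : ∀ᶠ N in (U : Filter ℕ), h N < r / (4 * M) :=
          hh0.eventually (gt_mem_nhds (by positivity))
        filter_upwards [hev1, hev2] with N hN1 hN2
        rw [lt_div_iff₀ (by positivity)] at hN2
        have h3 := sq_norm_euler_sub_le (f := f) hcl hK hz₀ (hh N).le hM hv (G := G) (k N t)
          (k N (t + δ) - k N t) ?_
        · rwa [Nat.add_sub_cancel' (hk N htδ)] at h3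
        · intro i hi
          refine (hball ?_).le
          have h4 := norm_euler_sub_le (f := f) hcl hK hz₀ (hh N).le hM (k N t) i
          have h5 : (i : ℝ) * h N ≤ δ + h N := by
            have h6 := hcount N htδ
            rw [add_sub_cancel_left] at h6
            exact (mul_le_mul_of_nonneg_right (Nat.cast_le.2 hi.le) (hh N).le).trans h6
          have h7 := mul_le_mul_of_nonneg_right h5 hMpos.le
          rw [← dist_eq_norm] at h4
          have h8 := dist_triangle (a N (k N t + i)) (a N (k N t)) (x t)
          change dist (a N (k N t + i)) (a N (k N t)) ≤ _ at h4
          change dist (a N (k N t + i)) (x t) < r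
          linarith
      have hder : HasDerivAt (fun s => ‖x s - v‖ ^ 2) (2 * inner ℝ (d - 0) (x t - v)) t :=
        HasDerivAt.norm_sub_sq hd (hasDerivAt_const t v)
      rw [sub_zero] at hder
      have hslope := hder.tendsto_slope_zero_right
      have hle : 2 * inner ℝ d (x t - v) ≤ 2 * G := by
        refine le_of_tendsto hslope ?_
        filter_upwards [hest, self_mem_nhdsWithin] with δ hδ hδ0
        have hδ0 : 0 < δ := hδ0
        rw [smul_eq_mul, inv_mul_le_iff₀ hδ0]
        exact hδ
      linarith
    have h1 := le_of_forall_pos_le_add key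
    rw [← neg_sub (x t) v, inner_neg_right, inner_sub_left]
    linarith

/-- A Lipschitz curve is differentiable almost everywhere, so a condition on the derivatives that
exist suffices. -/
theorem isSolution_of_lipschitzWith {M : ℝ≥0} {x : ℝ → Space n m} (hL : LipschitzWith M x)
    (hmem : ∀ t ≥ 0, x t ∈ K)
    (hd : ∀ t > 0, ∀ d, HasDerivAt x d t → f (x t) - d ∈ normalCone K (x t)) :
    IsSolution f K x where
  ac _ _ := hL.lipschitzOnWith.absolutelyContinuousOnInterval
  mem := hmem
  ae_deriv := hL.ae_differentiableAt_real.mono fun t ht ht0 =>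
    ⟨_, ht.hasDerivAt, hd t ht0 _ ht.hasDerivAt⟩

/-- Existence for the projected dynamics of a continuous dissipative field that has a stationary
point. -/
theorem exists_curve (hf : Continuous f) (hdis : Dissipative f) (hcl : IsClosed K)
    (hK : Convex ℝ K) {e : Space n m} (he : e ∈ K) (hfe : f e ∈ normalCone K e) (hz₀ : z₀ ∈ K) :
    ∃ (M : ℝ≥0) (x : ℝ → Space n m), LipschitzWith M x ∧ x 0 = z₀ ∧
      (∀ t ≥ 0, x t ∈ K) ∧
      ∀ t > 0, ∀ d, HasDerivAt x d t → f (x t) - d ∈ normalCone K (x t) := by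
  -- The distance to `e` does not increase, so with the extra `1` the curve stays in the open ball
  -- and the truncation to the closed ball is never active.
  set R := ‖z₀ - e‖ + 1
  have hR : 0 < R := by positivity
  have hez : z₀ ∈ K ∩ Metric.closedBall e R :=
    ⟨hz₀, by rw [Metric.mem_closedBall, dist_eq_norm]; exact (lt_add_one _).le⟩
  obtain ⟨M, x, hL, h0, hmem, hd⟩ := exists_curve_of_isCompact hf
    ((isCompact_closedBall e R).inter_left hcl) (hK.inter (convex_closedBall e R)) hez
  refine ⟨M, x, hL, h0, fun t _ => (hmem t).1, fun t ht d hdt v hv => ?_⟩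
  have hsol : IsSolution f (K ∩ Metric.closedBall e R) x :=
    isSolution_of_lipschitzWith hL (fun t _ => hmem t) hd
  have hconst : IsSolution f (K ∩ Metric.closedBall e R) fun _ => e :=
    isSolution_const ⟨he, Metric.mem_closedBall_self hR.le⟩ fun v hv => hfe v hv.1
  have hdist : ‖x t - e‖ < R := by
    have h1 := hsol.norm_sub_le hdis hconst le_rfl ht.le
    rw [h0] at h1
    exact h1.trans_lt (lt_add_one _)
  -- A short step from `x t` towards `v` stays in the ball; the normal cone inequality there scales
  -- up to `v`.
  have hev : ∀ᶠ r : ℝ in 𝓝[>] 0, x t + r • (v - x t) ∈ Metric.closedBall e R := by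
    have hc : Tendsto (fun r : ℝ => x t + r • (v - x t)) (𝓝[>] 0) (𝓝 (x t)) := by
      have : Continuous fun r : ℝ => x t + r • (v - x t) := by fun_prop
      simpa using (this.tendsto 0).mono_left nhdsWithin_le_nhds
    refine hc.eventually (Metric.closedBall_mem_nhds_of_mem ?_)
    rwa [Metric.mem_ball, dist_eq_norm]
  have hlt : ∀ᶠ r : ℝ in 𝓝[>] 0, r < 1 := nhdsWithin_le_nhds (gt_mem_nhds zero_lt_one)
  obtain ⟨r, hrb, hr1, hr0⟩ := (hev.and (hlt.and self_mem_nhdsWithin)).exists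
  have hr0 : 0 < r := hr0
  have h1 := hd t ht d hdt (x t + r • (v - x t))
    ⟨hK.add_smul_sub_mem (hmem t).1 hv ⟨hr0.le, hr1.le⟩, hrb⟩
  rw [add_sub_cancel_left, real_inner_smul_right] at h1
  exact nonpos_of_mul_nonpos_right h1 hr0

end Existence

end Subgradient

namespace Subgradient

/-! ### Limit sets of nonexpansive semi-flows -/

section NonexpansiveFlow

variable {X : Type*} [MetricSpace X] {Φ : Flow ℝ≥0 X} {x z w e : X}

theorem exists_dist_lt_of_mapClusterPt (hz : MapClusterPt z atTop fun t => Φ t x) {ε : ℝ}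
    (hε : 0 < ε) (T : ℝ≥0) : ∃ t ≥ T, dist (Φ t x) z < ε :=
  frequently_atTop.1 (mapClusterPt_iff_frequently.1 hz _ (Metric.ball_mem_nhds z hε)) T

theorem mapClusterPt_flow (hz : MapClusterPt z atTop fun t => Φ t x) (s : ℝ≥0) :
    MapClusterPt (Φ s z) atTop fun t => Φ t x := by
  have h1 := hz.continuousAt_comp (Φ.continuous_toFun s).continuousAt
  have e : (Φ.toFun s ∘ fun t => Φ t x) = (fun t => Φ t x) ∘ fun t => s + t := by
    ext t
    exact (Φ.map_add s t x).symm
  rw [e] at h1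
  exact MapClusterPt.of_comp (tendsto_atTop_mono (fun _ => le_add_self) tendsto_id) h1

/-- A semi-flow maps the set of limit points of a relatively compact trajectory onto itself. -/
theorem exists_flow_eq_of_mapClusterPt {S : Set X} (hS : IsCompact S) (hx : ∀ t, Φ t x ∈ S)
    (hw : MapClusterPt w atTop fun t => Φ t x) (s : ℝ≥0) :
    ∃ v, MapClusterPt v atTop (fun t => Φ t x) ∧ Φ s v = w := by
  obtain ⟨U, hU, hUw⟩ := mapClusterPt_iff_ultrafilter.1 hw
  -- The preimage is a limit of the trajectory delayed by `s`; truncated subtraction is harmless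
  -- because eventually `t ≥ s`.
  obtain ⟨v, -, hv⟩ := hS.ultrafilter_le_nhds (U.map fun t => Φ (t - s) x)
    (le_principal_iff.2 (Ultrafilter.mem_map.2 (univ_mem' fun t => hx _)))
  have hv : Tendsto (fun t => Φ (t - s) x) U (𝓝 v) := hv
  have hsub : Tendsto (fun t : ℝ≥0 => t - s) atTop atTop := by
    refine tendsto_atTop.2 fun b => ?_
    filter_upwards [eventually_ge_atTop (b + s)] with t ht using le_tsub_of_add_le_right ht
  refine ⟨v, ?_, ?_⟩
  · exact MapClusterPt.of_comp (φ := fun t : ℝ≥0 => t - s) hsub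
      (mapClusterPt_iff_ultrafilter.2 ⟨U, hU, hv⟩)
  · refine tendsto_nhds_unique (((Φ.continuous_toFun s).tendsto v).comp hv) (hUw.congr' ?_)
    filter_upwards [hU (eventually_ge_atTop s)] with t ht
    have ht : s ≤ t := ht
    rw [Function.comp_apply]
    change Φ t x = Φ s (Φ (t - s) x)
    rw [← Φ.map_add, add_tsub_cancel_of_le ht]

/-- Limit points of a trajectory of a nonexpansive semi-flow are simultaneously recurrent. -/
theorem exists_recurrence_time
    (hΦ : ∀ (t : ℝ≥0) (p q : X), dist (Φ t p) (Φ t q) ≤ dist p q)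
    (hz : MapClusterPt z atTop fun t => Φ t x)
    (hw : MapClusterPt w atTop fun t => Φ t x) {ε : ℝ} (hε : 0 < ε) (T : ℝ≥0) :
    ∃ t ≥ T, dist (Φ t z) z < ε ∧ dist (Φ t w) w < ε := by
  have hε' : 0 < ε / 4 := by positivity
  -- The trajectory is near `z` at time `a`, near `w` at `a + s`, and near `z` again at `a + T + r`.
  -- By nonexpansiveness the return after `T + r` persists when everything is moved forward by `s`,
  -- so the same time serves `w`.
  obtain ⟨a, -, ha⟩ := exists_dist_lt_of_mapClusterPt hz hε' 0
  obtain ⟨b, hab, hb⟩ := exists_dist_lt_of_mapClusterPt hw hε' a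
  obtain ⟨c, hc, hcz⟩ := exists_dist_lt_of_mapClusterPt hz hε' (a + T)
  obtain ⟨s, rfl⟩ := exists_add_of_le hab
  obtain ⟨r, rfl⟩ := exists_add_of_le hc
  have hac : dist (Φ (a + T + r) x) (Φ a x) < ε / 2 := by
    have := dist_triangle_right (Φ (a + T + r) x) (Φ a x) z
    linarith
  have e1 : Φ (T + r) (Φ a x) = Φ (a + T + r) x := by
    rw [← Φ.map_add]; congr 1; ring
  have e2 : Φ (T + r) (Φ (a + s) x) = Φ s (Φ (a + T + r) x) := by
    rw [← Φ.map_add, ← Φ.map_add]; congr 1; ring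
  have e3 : Φ (a + s) x = Φ s (Φ a x) := by
    rw [← Φ.map_add]; congr 1; ring
  refine ⟨T + r, le_self_add, ?_, ?_⟩
  · have h1 := hΦ (T + r) (Φ a x) z
    have h2 := dist_triangle_left (Φ (T + r) z) z (Φ (T + r) (Φ a x))
    rw [e1] at h1 h2
    linarith
  · have h1 := hΦ (T + r) (Φ (a + s) x) w
    have h2 := dist_triangle_left (Φ (T + r) w) w (Φ (T + r) (Φ (a + s) x))
    have h3 := hΦ s (Φ (a + T + r) x) (Φ a x)
    have h4 := dist_triangle (Φ s (Φ (a + T + r) x)) (Φ s (Φ a x)) w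
    rw [e2] at h1 h2
    rw [← e3] at h3 h4
    linarith

/-- A nonexpansive semi-flow is isometric on the limit points of a trajectory. -/
theorem dist_flow_eq_of_mapClusterPt
    (hΦ : ∀ (t : ℝ≥0) (p q : X), dist (Φ t p) (Φ t q) ≤ dist p q)
    (hz : MapClusterPt z atTop fun t => Φ t x)
    (hw : MapClusterPt w atTop fun t => Φ t x) (s : ℝ≥0) : dist (Φ s z) (Φ s w) = dist z w := by
  refine le_antisymm (hΦ s z w) (le_of_forall_pos_le_add fun ε hε => ?_)
  obtain ⟨t, ht, h1, h2⟩ := exists_recurrence_time hΦ hz hw (half_pos hε) s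
  obtain ⟨r, rfl⟩ := exists_add_of_le ht
  have h3 := hΦ r (Φ s z) (Φ s w)
  rw [← Φ.map_add, ← Φ.map_add, add_comm r s] at h3
  have h4 := dist_triangle4 z (Φ (s + r) z) (Φ (s + r) w) w
  rw [dist_comm z (Φ (s + r) z)] at h4
  linarith

/-- The fixed point `e` need not be a limit point; recurrence of `z` alone excludes any loss of
distance. -/
theorem dist_flow_fixed_eq_of_mapClusterPt
    (hΦ : ∀ (t : ℝ≥0) (p q : X), dist (Φ t p) (Φ t q) ≤ dist p q)
    (hz : MapClusterPt z atTop fun t => Φ t x)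
    (he : ∀ t, Φ t e = e) (s : ℝ≥0) : dist (Φ s z) e = dist z e := by
  refine le_antisymm (by simpa [he] using hΦ s z e) (le_of_forall_pos_le_add fun ε hε => ?_)
  obtain ⟨t, ht, h1, -⟩ := exists_recurrence_time hΦ hz hz hε s
  obtain ⟨r, rfl⟩ := exists_add_of_le ht
  have h3 := hΦ r (Φ s z) e
  rw [he, ← Φ.map_add, add_comm r s] at h3
  have h4 := dist_triangle_left z e (Φ (s + r) z)
  linarith

/-- A trajectory of a nonexpansive semi-flow with a stationary limit point converges to it. -/
theorem tendsto_infEDist_of_mapClusterPt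
    (hΦ : ∀ (t : ℝ≥0) (p q : X), dist (Φ t p) (Φ t q) ≤ dist p q)
    (he : MapClusterPt e atTop fun t => Φ t x)
    (hfix : ∀ t, Φ t e = e) :
    Tendsto (fun t : ℝ≥0 => Metric.infEDist (Φ t x) {p | ∀ s : ℝ≥0, Φ s p = p}) atTop (𝓝 0) := by
  have h1 : Tendsto (fun t => Φ t x) atTop (𝓝 e) := by
    refine Metric.tendsto_atTop.2 fun ε hε => ?_
    obtain ⟨T, -, hT⟩ := exists_dist_lt_of_mapClusterPt he hε 0
    refine ⟨T, fun t ht => ?_⟩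
    obtain ⟨r, rfl⟩ := exists_add_of_le ht
    have h := hΦ r (Φ T x) e
    rw [hfix, ← Φ.map_add, add_comm r T] at h
    exact h.trans_lt hT
  have h2 : Metric.infEDist e {p | ∀ s : ℝ≥0, Φ s p = p} = 0 :=
    Metric.infEDist_zero_of_mem hfix
  rw [← h2]
  exact (Metric.continuous_infEDist.tendsto e).comp h1

theorem isClosed_setOf_fixed : IsClosed {p | ∀ s : ℝ≥0, Φ s p = p} := by
  have : {p | ∀ s : ℝ≥0, Φ s p = p} = ⋂ s : ℝ≥0, {p | Φ s p = p} := by ext; simp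
  rw [this]
  exact isClosed_iInter fun s => isClosed_eq (Φ.continuous_toFun s) continuous_id

/-- Limit points of trajectories of a globally convergent semi-flow are stationary. -/
theorem GloballyConvergent.flow_eq_of_mapClusterPt (h : GloballyConvergent Φ)
    (hz : MapClusterPt z atTop fun t => Φ t x) (s : ℝ≥0) : Φ s z = z := by
  obtain ⟨U, hU, hUz⟩ := mapClusterPt_iff_ultrafilter.1 hz
  have h1 := tendsto_nhds_unique ((Metric.continuous_infEDist.tendsto z).comp hUz)
    ((h x).mono_left hU)
  exact (Metric.mem_iff_infEDist_zero_of_closed isClosed_setOf_fixed).2 h1 s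

end NonexpansiveFlow

variable {n m : ℕ}

/-! ### The semi-flow of the projected dynamics -/

section FlowExistence

variable {f : Space n m → Space n m} {K : Set (Space n m)}

/-- The projected dynamics of a continuous dissipative field that has a stationary point generates
a semi-flow. -/
theorem exists_flow (hf : Continuous f) (hdis : Dissipative f) (hcl : IsClosed K)
    (hK : Convex ℝ K) {e : Space n m} (he : e ∈ K) (hfe : f e ∈ normalCone K e) :
    ∃ Φ : Flow ℝ≥0 K, ∀ z : K, IsSolution f K fun t => (Φ t.toNNReal z : Space n m) := by
  choose M x hL h0 hmem hd using
    fun z : K => exists_curve hf hdis hcl hK he hfe z.2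
  have hsol : ∀ z, IsSolution f K (x z) := fun z =>
    isSolution_of_lipschitzWith (hL z) (hmem z) (hd z)
  have hshift : ∀ (z : K) (s : ℝ), 0 ≤ s → IsSolution f K fun t => x z (s + t) := by
    intro z s hs
    refine isSolution_of_lipschitzWith (M := M z)
      (fun a b => by simpa using hL z (s + a) (s + b))
      (fun t ht => hmem z _ (add_nonneg hs ht)) fun t ht d hdt => ?_
    refine hd z _ (add_pos_of_nonneg_of_pos hs ht) d ?_
    have h1 : HasDerivAt (fun t => x z (s + t)) d (-s + (s + t)) := by
      rwa [neg_add_cancel_left]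
    simpa using h1.comp_const_add (-s) (s + t)
  refine ⟨⟨fun t z => ⟨x z t, hmem z t t.2⟩, ?_, ?_, ?_⟩, fun z => ?_⟩
  · refine Continuous.subtype_mk ?_ _
    -- Joint continuity: 1-Lipschitz in the initial point, uniformly in time, and continuous in
    -- time.
    refine continuous_prod_of_continuous_lipschitzWith' _ 1 (fun t => ?_) fun z => ?_
    · refine LipschitzWith.of_dist_le_mul fun z w => ?_
      have h := (hsol z).norm_sub_le hdis (hsol w) le_rfl t.2
      rw [h0, h0] at h
      rw [NNReal.coe_one, one_mul, Subtype.dist_eq, dist_eq_norm, dist_eq_norm]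
      exact h
    · exact (hL z).continuous.comp NNReal.continuous_coe
  · intro t s z
    refine Subtype.ext ?_
    have h := (hshift z s s.2).eq_of_eq_zero hdis (hsol ⟨x z s, hmem z s s.2⟩)
      (by simp [h0]) t.2
    simpa [add_comm] using h
  · exact fun z => Subtype.ext (h0 z)
  · change IsSolution f K fun t => x z (t.toNNReal : ℝ)
    refine isSolution_of_lipschitzWith (M := M z * 1)
      ((hL z).comp (LipschitzWith.id.max_const 0)) (fun t ht => hmem z _ (NNReal.coe_nonneg _)) ?_
    intro t ht d hdt
    have e : ∀ᶠ s : ℝ in 𝓝 t, x z s = x z (s.toNNReal : ℝ) := by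
      filter_upwards [Ioi_mem_nhds ht] with s hs
      rw [Real.coe_toNNReal s (le_of_lt hs)]
    have h := hd z t ht d (hdt.congr_of_eventuallyEq e)
    rwa [e.self_of_nhds] at h

end FlowExistence

/-! ### Faces and normal vectors -/

section Faces

variable {f : Space n m → Space n m} {K : Set (Space n m)}

/-- A normal vector exposes a face. -/
theorem isFace_setOf_inner_eq_zero (hK : Convex ℝ K) {z p : Space n m} (hp : p ∈ normalCone K z) :
    IsFace K {v | v ∈ K ∧ inner ℝ p (v - z) = 0} := by
  have hcomb : ∀ (a b : Space n m) (s t : ℝ), s + t = 1 →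
      inner ℝ p (s • a + t • b - z) = s * inner ℝ p (a - z) + t * inner ℝ p (b - z) := by
    intro a b s t hst
    rw [← real_inner_smul_right, ← real_inner_smul_right, ← inner_add_right]
    congr 1
    calc s • a + t • b - z = s • a + t • b - (s + t) • z := by rw [hst, one_smul]
      _ = s • (a - z) + t • (b - z) := by module
  refine ⟨?_, ?_, ?_⟩
  · rintro a ⟨ha, ha0⟩ b ⟨hb, hb0⟩ s t hs ht hst
    exact ⟨hK ha hb hs ht hst, by rw [hcomb a b s t hst, ha0, hb0]; simp⟩
  · exact fun v hv => hv.1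
  · rintro a ha b hb _ ⟨-, h0⟩ ⟨s, t, hs, ht, hst, rfl⟩
    refine ⟨ha, ?_⟩
    rw [hcomb a b s t hst] at h0
    have h1 := hp a ha
    have h2 := mul_nonpos_of_nonneg_of_nonpos ht.le (hp b hb)
    refine le_antisymm h1 ?_
    exact nonneg_of_mul_nonneg_right (by linarith) hs

/-- The smallest face of `K` that contains `A`. -/
theorem isFace_sInter (hK : Convex ℝ K) {A : Set (Space n m)} (hA : A ⊆ K) :
    IsFace K (⋂₀ {G | IsFace K G ∧ A ⊆ G}) :=
  ⟨convex_sInter fun _ hG => hG.1.1,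
    isExtreme_sInter ⟨K, ⟨hK, IsExtreme.refl ℝ K⟩, hA⟩ fun _ hG => hG.1.2⟩

/-- The normal components of two solutions at constant distance are orthogonal to the difference of
the solutions. -/
theorem IsSolution.inner_normal_eq_zero (hf : Dissipative f) {x y : ℝ → Space n m}
    (hx : IsSolution f K x) (hy : IsSolution f K y)
    (hxy : ∀ t ≥ 0, ‖x t - y t‖ = ‖x 0 - y 0‖) :
    ∀ᵐ t : ℝ, 0 < t → ∀ d, HasDerivAt x d t → inner ℝ (f (x t) - d) (y t - x t) = 0 := by
  filter_upwards [hx.ae_deriv, hy.ae_deriv] with t htx hty ht d hd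
  obtain ⟨d', hd', hdn⟩ := htx ht
  obtain rfl := hd'.unique hd
  obtain ⟨e, he, hen⟩ := hty ht
  have h0 : HasDerivAt (fun s => ‖x s - y s‖ ^ 2) 0 t := by
    refine (hasDerivAt_const t (‖x 0 - y 0‖ ^ 2)).congr_of_eventuallyEq ?_
    filter_upwards [Ioi_mem_nhds ht] with s hs
    rw [hxy s (le_of_lt hs)]
  have h1 := (HasDerivAt.norm_sub_sq hd he).unique h0
  have h2 := hdn _ (hy.mem t ht.le)
  have h3 := hen _ (hx.mem t ht.le)
  have h4 := hf (x t) (y t)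
  -- In this splitting the velocity term vanishes and both normal terms, paired with `x t - y t`,
  -- have the same sign, while the total is at most zero; hence each vanishes.
  have e1 : f (x t) - f (y t) = (f (x t) - d') - (f (y t) - e) + (d' - e) := by abel
  rw [e1, inner_add_left, inner_sub_left] at h4
  rw [← neg_sub (y t) (x t), inner_neg_right, inner_neg_right, inner_neg_right] at h4
  rw [← neg_sub (y t) (x t), inner_neg_right] at h3 h1
  linarith

theorem mem_normalCone_affineSpan {F : Set (Space n m)} {p z : Space n m}
    (h : ∀ v ∈ F, inner ℝ p (v - z) = 0) :
    p ∈ normalCone (affineSpan ℝ F : Set (Space n m)) z := by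
  intro v hv
  refine le_of_eq (affineSpan_induction (p := fun v => inner ℝ p (v - z) = 0) hv h ?_)
  intro c u v w hu hv hw
  have e : (c • (u -ᵥ v) +ᵥ w) - z = c • ((u - z) - (v - z)) + (w - z) := by
    simp only [vsub_eq_sub, vadd_eq_add]
    module
  rw [e, inner_add_right, real_inner_smul_right, inner_sub_right, hu, hv, hw]
  simp

end Faces

end Subgradient

/-! ### Passage to the affine span of a face -/

namespace Subgradient

variable {n m : ℕ} {f : Space n m → Space n m} {K : Set (Space n m)} {Φ : Flow ℝ≥0 K}

theorem flow_dist_le (hdis : Dissipative f)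
    (hΦ : ∀ z : K, IsSolution f K fun t => (Φ t.toNNReal z : Space n m)) (t : ℝ≥0) (p q : K) :
    dist (Φ t p) (Φ t q) ≤ dist p q := by
  have h := (hΦ p).norm_sub_le hdis (hΦ q) le_rfl t.2
  simpa [Subtype.dist_eq, dist_eq_norm, Φ.map_zero_apply] using h

theorem flow_eq_of_mem_normalCone (hdis : Dissipative f)
    (hΦ : ∀ z : K, IsSolution f K fun t => (Φ t.toNNReal z : Space n m)) (e : K)
    (he : f e ∈ normalCone K (e : Space n m)) (t : ℝ≥0) : Φ t e = e := by
  have h := (hΦ e).eq_of_eq_zero hdis (isSolution_const e.2 he)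
    (by simp [Φ.map_zero_apply]) t.2
  simpa [Subtype.ext_iff] using h

/-- On the limit points of a trajectory, the projected dynamics on `K` is the projected dynamics on
the affine span of the smallest face containing these limit points and a given stationary point. -/
theorem isSolution_affineSpan_of_mapClusterPt (hcl : IsClosed K) (hK : Convex ℝ K)
    (hdis : Dissipative f) (hΦ : ∀ z : K, IsSolution f K fun t => (Φ t.toNNReal z : Space n m))
    {e : K} (he : f e ∈ normalCone K (e : Space n m)) {x z : K}
    (hz : MapClusterPt z atTop fun t => Φ t x) {F : Set (Space n m)}
    (hWF : ∀ v : K, MapClusterPt v atTop (fun t => Φ t x) → (v : Space n m) ∈ F)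
    (hF : ∀ G, IsFace K G → (e : Space n m) ∈ G →
      (∀ v : K, MapClusterPt v atTop (fun t => Φ t x) → (v : Space n m) ∈ G) → F ⊆ G) :
    IsSolution f (affineSpan ℝ F : Set (Space n m)) fun t => (Φ t.toNNReal z : Space n m) := by
  have hne := flow_dist_le hdis hΦ
  have hfix := flow_eq_of_mem_normalCone hdis hΦ e he
  have : ProperSpace K := ProperSpace.of_isClosed hcl
  have hS : IsCompact (Metric.closedBall e (dist x e)) := isCompact_closedBall _ _
  have hxS : ∀ t, Φ t x ∈ Metric.closedBall e (dist x e) := fun t => by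
    simpa [hfix] using hne t x e
  let W : Set K := {v | MapClusterPt v atTop fun t => Φ t x}
  -- Each limit point brings its own exceptional null set of times; a countable dense subset gives
  -- one common null set.
  obtain ⟨D, hDc, hDd⟩ := TopologicalSpace.exists_countable_dense W
  have hW : ∀ᵐ t : ℝ, ∀ w ∈ D, 0 < t → ∀ d,
      HasDerivAt (fun t : ℝ => (Φ t.toNNReal z : Space n m)) d t →
      inner ℝ (f (Φ t.toNNReal z) - d)
        ((Φ t.toNNReal w : Space n m) - (Φ t.toNNReal z : Space n m)) = 0 := by
    refine (ae_ball_iff hDc).2 fun w _ => ?_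
    refine (hΦ z).inner_normal_eq_zero hdis (hΦ w) fun t _ => ?_
    have h := dist_flow_eq_of_mapClusterPt hne hz w.2 t.toNNReal
    simpa [Subtype.dist_eq, dist_eq_norm, Φ.map_zero_apply] using h
  have hE := (hΦ z).inner_normal_eq_zero hdis (isSolution_const e.2 he) fun t _ => by
    have h := dist_flow_fixed_eq_of_mapClusterPt hne hz hfix t.toNNReal
    simpa [Subtype.dist_eq, dist_eq_norm, Φ.map_zero_apply] using h
  refine ⟨(hΦ z).ac, fun t _ => subset_affineSpan ℝ F (hWF _ (mapClusterPt_flow hz _)), ?_⟩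
  filter_upwards [(hΦ z).ae_deriv, hW, hE] with t ht htW htE ht0
  obtain ⟨d, hd, hdn⟩ := ht ht0
  refine ⟨d, hd, mem_normalCone_affineSpan fun v hv => ?_⟩
  refine (hF _ (isFace_setOf_inner_eq_zero hK hdn) ⟨e.2, htE ht0 d hd⟩ (fun w hw => ⟨w.2, ?_⟩)
    hv).2
  -- Orthogonality is known against the moved points `Φ t w'`; these exhaust the limit set, and
  -- density of `D` gives all of them.
  obtain ⟨w', hw', rfl⟩ := exists_flow_eq_of_mapClusterPt hS hxS hw t.toNNReal
  have hclosed : IsClosed {u : W | inner ℝ (f (Φ t.toNNReal z) - d)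
      ((Φ t.toNNReal u : Space n m) - (Φ t.toNNReal z : Space n m)) = 0} := by
    refine isClosed_eq (continuous_const.inner (Continuous.sub ?_ continuous_const))
      continuous_const
    exact continuous_subtype_val.comp ((Φ.continuous_toFun _).comp continuous_subtype_val)
  have h := hclosed.closure_subset_iff.2 (fun u hu => htW u hu ht0 d hd) (hDd ⟨w', hw'⟩)
  exact h

end Subgradient

theorem mainTheorem8 (n m : ℕ) (K : Set (Subgradient.Space n m)) (hne : K.Nonempty)
    (hcl : IsClosed K) (hconv : Convex ℝ K) (φ : Subgradient.Space n m → ℝ)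
    (hC2 : ContDiff ℝ 2 φ) (hcc : Subgradient.ConcaveConvex φ)
    (hsaddle : ∃ z, Subgradient.IsStationarySaddlePoint φ K z)
    (hfaces : ∀ F : Set (Subgradient.Space n m), Subgradient.IsFace K F →
      (∃ z ∈ F, Subgradient.IsStationarySaddlePoint φ K z) →
        Subgradient.SubgradientMethodConverges φ
          (affineSpan ℝ F : Set (Subgradient.Space n m))) :
    Subgradient.SubgradientMethodConverges φ K := by
  open Subgradient in
  have hdis : Dissipative (gradField φ) :=
    dissipative_gradField (hC2.differentiable two_ne_zero) hcc
  have hcont : Continuous (gradField φ) := continuous_gradField (hC2.of_le one_le_two)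
  obtain ⟨e, hsad⟩ := hsaddle
  have heK : e ∈ K := hsad.1.1
  obtain ⟨Φ, hΦ⟩ := exists_flow hcont hdis hcl hconv heK hsad.2
  refine ⟨Φ, fun z => (hΦ z).isCaratheodorySolution, fun x => ?_⟩
  have hnon := flow_dist_le hdis hΦ
  have hfix := flow_eq_of_mem_normalCone hdis hΦ ⟨e, heK⟩ hsad.2
  have : ProperSpace K := ProperSpace.of_isClosed hcl
  have hcluster : ∀ z : K, ∃ w, MapClusterPt w atTop fun t => Φ t z := fun z => by
    obtain ⟨w, -, hw⟩ := (isCompact_closedBall (⟨e, heK⟩ : K)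
      (dist z ⟨e, heK⟩)).exists_mapClusterPt (f := atTop) (u := fun t => Φ t z)
      (le_principal_iff.2 (mem_map.2 (univ_mem' fun t => by simpa [hfix] using hnon t z ⟨e, heK⟩)))
    exact ⟨w, hw⟩
  obtain ⟨z, hz⟩ := hcluster x
  -- Including `e` ensures that `F` contains a stationary saddle point, as `hfaces` requires.
  set A : Set (Space n m) := insert e {v | ∃ h : v ∈ K, MapClusterPt ⟨v, h⟩ atTop fun t => Φ t x}
  have hAK : A ⊆ K := by
    rintro v (rfl | ⟨h, -⟩)
    exacts [heK, h]
  set F := ⋂₀ {G | IsFace K G ∧ A ⊆ G}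
  have hAF : A ⊆ F := subset_sInter fun G hG => hG.2
  have hsol : ∀ v : K, MapClusterPt v atTop (fun t => Φ t x) →
      IsSolution (gradField φ) (affineSpan ℝ F : Set (Space n m))
        fun t => (Φ t.toNNReal v : Space n m) := fun v hv => by
    refine isSolution_affineSpan_of_mapClusterPt hcl hconv hdis hΦ (e := ⟨e, heK⟩) hsad.2 hv
      (fun w hw => hAF (Or.inr ⟨w.2, hw⟩)) fun G hG heG hWG => sInter_subset_of_mem ⟨hG, ?_⟩
    rintro w (rfl | ⟨h, hw⟩)
    exacts [heG, hWG ⟨w, h⟩ hw]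
  obtain ⟨Ψ, hΨ, hΨconv⟩ := hfaces F (isFace_sInter hconv hAK) ⟨e, hAF (Or.inl rfl), hsad⟩
  have hmemF : ∀ v : K, MapClusterPt v atTop (fun t => Φ t x) →
      (v : Space n m) ∈ (affineSpan ℝ F : Set (Space n m)) :=
    fun v hv => subset_affineSpan ℝ F (hAF (Or.inr ⟨v.2, hv⟩))
  have hagree : ∀ (v : K) (hv : MapClusterPt v atTop fun t => Φ t x) (t : ℝ≥0),
      (Φ t v : Space n m) = Ψ t ⟨v, hmemF v hv⟩ := fun v hv t => by
    have h := (hsol v hv).eq_of_eq_zero hdis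
      (isSolution_of_isCaratheodorySolution (hΨ ⟨v, hmemF v hv⟩) fun t _ => (Ψ _ _).2)
      (by simp [Φ.map_zero_apply, Ψ.map_zero_apply]) t.2
    simpa using h
  -- The trajectory of `x` itself may avoid the span; that of its limit point `z` is a trajectory of
  -- `Ψ`, so `q` is stationary for `Ψ`.
  obtain ⟨q, hq⟩ := hcluster z
  have hqx : MapClusterPt q atTop fun t => Φ t x :=
    isClosed_setOfPred_clusterPt.mem_of_mapClusterPt hq
      (Eventually.of_forall fun t => mapClusterPt_flow hz t)
  have hqΨ : MapClusterPt (⟨q, hmemF q hqx⟩ : (affineSpan ℝ F : Set (Space n m))) atTop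
      fun t => Ψ t ⟨z, hmemF z hz⟩ := by
    obtain ⟨U, hU, hUq⟩ := mapClusterPt_iff_ultrafilter.1 hq
    refine mapClusterPt_iff_ultrafilter.2 ⟨U, hU, tendsto_subtype_rng.2 ?_⟩
    simpa only [← hagree z hz, Function.comp_def] using (continuous_subtype_val.tendsto q).comp hUq
  refine tendsto_infEDist_of_mapClusterPt hnon hqx fun t => Subtype.ext ?_
  rw [hagree q hqx, hΨconv.flow_eq_of_mapClusterPt hqΨ]
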